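/- Let $\alpha,\beta>-1$. Let $P_m^{(\alpha,\beta)}$ ($m\ge 0$) be the Jacobi polynomials, put $g_m^{(\alpha,\beta)}=\int_{-1}^1(1-t)^\alpha(1+t)^\beta P_m^{(\alpha,\beta)}(t)^2\,dt$, and define the tanh-Jacobi functions $$\varphi_m^{(\alpha,\beta)}(x)=\frac{(-1)^m}{\sqrt{g_m^{(\alpha,\beta)}}}\,(1-\tanh x)^{\frac{\alpha+1}{2}}(1+\tanh x)^{\frac{\beta+1}{2}}\,P_m^{(\alpha,\beta)}(\tanh x),\qquad x\in\mathbb R,\ m\ge 0.$$ Let $g_{\alpha,\beta}(\xi)=\frac1{\sqrt{2\pi}}\int_{\mathbb R}\varphi_0^{(\alpha,\beta)}(x)e^{-ix\xi}\,dx$ and let $d\mu_{\alpha,\beta}(\xi)=|g_{\alpha,\beta}(\xi)|^2\,d\xi$ be the associated measure on $\mathbb R$ in Fourier space. Then, over the real as well as over the complex scalars: 1. The functions $\varphi_m^{(\alpha,\beta)}$, $m\ge 0$, belong to $L_2(\mathbb R)$, and $\Phi^{(\alpha,\beta)}=\{\varphi_m^{(\alpha,\beta)}\}_{m\ge0}$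 is a complete orthonormal system in $L_2(\mathbb R)$: it is orthonormal, and its closed linear span is $L_2(\mathbb R)$. 2. The weight never vanishes: $|g_{\alpha,\beta}(\xi)|^2>0$ for every $\xi\in\mathbb R$. 3. There is a constant $C_{\alpha,\beta}>0$ such that $$g_{\alpha,\beta}(\xi)=C_{\alpha,\beta}\,\Gamma\!\left(\tfrac{\alpha+1}{2}+\tfrac{i\xi}{2}\right)\Gamma\!\left(\tfrac{\beta+1}{2}-\tfrac{i\xi}{2}\right)\qquad(\xi\in\mathbb R),$$ and the weight decays exponentially, namely $$|g_{\alpha,\beta}(\xi)|^2\sim 4\pi^2C_{\alpha,\beta}^2\left|\tfrac{\xi}{2}\right|^{\alpha+\beta}e^{-\pi|\xi|}\qquad\text{as }|\xi|\to\infty.$$ 4. All polynomials belong to $L_2(\mathbb R,d\mu_{\alpha,\beta})$, and they are dense in it. -/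

import Mathlib

open scoped Polynomial

namespace TanhJacobi

noncomputable section

/-- The Jacobi polynomial `P_m^{(α,β)}` with the classical normalisation
`P_m^{(α,β)}(1) = (α+1)_m / m!`, namely
`∑_{k ≤ m} (α+β+m+1)_k (α+k+1)_{m-k} / (k! (m-k)!) ((t-1)/2)^k`, where `(a)_k` is the rising
factorial. This polynomial form is valid for all real `α`, `β`. -/
def jacobiPoly (α β : ℝ) (m : ℕ) : ℝ[X] :=
  ∑ k ∈ Finset.range (m + 1),
    Polynomial.C ((ascPochhammer ℝ k).eval (α + β + m + 1) *
        (ascPochhammer ℝ (m - k)).eval (α + k + 1) / (k.factorial * (m - k).factorial)) *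
      (Polynomial.C (1 / 2) * (Polynomial.X - 1)) ^ k

/-- The squared norm `g_m^{(α,β)} = ∫_{-1}^1 (1-t)^α (1+t)^β P_m^{(α,β)}(t)² dt`. -/
def jacobiNormSq (α β : ℝ) (m : ℕ) : ℝ :=
  ∫ t in (-1 : ℝ)..1, (1 - t) ^ α * (1 + t) ^ β * (jacobiPoly α β m).eval t ^ 2

/-- The tanh-Jacobi function `φ_m^{(α,β)}`. -/
def phi (α β : ℝ) (m : ℕ) (x : ℝ) : ℝ :=
  (-1) ^ m / √(jacobiNormSq α β m) *
    (1 - Real.tanh x) ^ ((α + 1) / 2) * (1 + Real.tanh x) ^ ((β + 1) / 2) *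
      (jacobiPoly α β m).eval (Real.tanh x)

/-- The Fourier-space function of the system: the unitary Fourier transform of `φ_0^{(α,β)}`,
`g_{α,β}(ξ) = (2π)^{-1/2} ∫ φ_0^{(α,β)}(x) e^{-ixξ} dx`. -/
def g (α β : ℝ) (ξ : ℝ) : ℂ :=
  ((√(2 * Real.pi))⁻¹ : ℝ) *
    ∫ x : ℝ, (phi α β 0 x : ℂ) * Complex.exp (-(Complex.I * x * ξ))

/-- The weight `w_{α,β} = |g_{α,β}|²`. -/
def weight (α β : ℝ) (ξ : ℝ) : ℝ := ‖g α β ξ‖ ^ 2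

/-- The measure `dμ_{α,β}(ξ) = |g_{α,β}(ξ)|² dξ`. -/
def mu (α β : ℝ) : MeasureTheory.Measure ℝ :=
  MeasureTheory.volume.withDensity fun ξ => ENNReal.ofReal (weight α β ξ)

end

end TanhJacobi

/-!
The substitution `t = tanh x`, `dt = (1 - tanh² x) dx`, carries `L²(ℝ)` to `L²(-1, 1)` in such a way
that the tanh-Jacobi functions become normalised Jacobi polynomials times the square root of the
Jacobi weight.

*Orthonormality.* It suffices to test `P_m` against `(1+t)^j`, `j < m`. Integrating the explicit sum
for `P_m` termwise with Euler's beta integral gives, up to a constant,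
`∑ k, (-1)^k (m choose k) q(k)` with a polynomial `q` of degree `m - 1 - j`, that is, a vanishing
`m`-th finite difference (`integral_jacobiWeight_mul_jacobiPoly_mul_pow`).

*Completeness.* As `P_m` has degree exactly `m`, a function orthogonal to all `φ_m` integrates to
zero against `v(x) p(tanh x)` for all polynomials `p`, where `v` is a positive multiple of `φ_0`.
By the Weierstrass theorem `p` may be replaced by any continuous function on `[-1, 1]`, and the
functions `p(tanh x)` then include all test functions
(`ae_eq_zero_of_integral_polynomial_tanh_mul_eq_zero`).

*The weight.* The same substitution turns the Fourier integral of `φ_0` into a beta integral, since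
`e^{2x} = (1 + tanh x) / (1 - tanh x)`; this is the formula for `g`
(`exists_g_eq_Gamma_mul_Gamma`). Nonvanishing is that of the Gamma function. For the decay one
needs `|Γ(σ + iy)|² ~ 2π |y|^{2σ-1} e^{-π|y|}` (`isEquivalent_norm_Gamma_sq`). On the line `σ = 1/2`
this is the reflection formula `|Γ(1/2 + iy)|² = π / cosh(πy)`, and the general line is compared
with it through Euler's limit formula (`abs_log_norm_Gamma_sq_sub_le`).

*Density of polynomials.* By the decay, `e^{2|ξ|}` is integrable against `μ`. If `f ∈ L²(μ)` is
orthogonal to all monomials, then `h = f |g|²` has vanishing moments and `e^{|ξ|} h` is integrable;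
so the Fourier transform of `h` is analytic in a strip with vanishing derivatives at the origin,
hence zero (`integral_exp_mul_eq_zero_of_moments_eq_zero`), and `f = 0` since `g` has no zeros.

Both completeness statements are reduced to real-valued functions, which treats the two scalar
fields at once (`topologicalClosure_span_eq_top_of_forall_real`).
-/

namespace TanhJacobi

open MeasureTheory Set Filter Topology

/-! ### Orthogonality of the Jacobi polynomials -/

/-- Euler's beta integral, transported to `[-1, 1]`, with complex exponents. -/
theorem integral_jacobiWeight_complex {u v : ℂ} (hu : 0 < u.re) (hv : 0 < v.re) :
    ∫ t in (-1 : ℝ)..1, (1 - t : ℂ) ^ (u - 1) * (1 + t : ℂ) ^ (v - 1) =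
      2 ^ (u + v - 1) * (Complex.Gamma u * Complex.Gamma v / Complex.Gamma (u + v)) := by
  have h := Complex.betaIntegral_scaled v u (a := 2) two_pos
  have hne : Complex.Gamma (v + u) ≠ 0 :=
    Complex.Gamma_ne_zero_of_re_pos (by simp only [Complex.add_re]; linarith)
  have hB : Complex.betaIntegral v u =
      Complex.Gamma u * Complex.Gamma v / Complex.Gamma (u + v) := by
    rw [add_comm u v, mul_comm (Complex.Gamma u), Complex.Gamma_mul_Gamma_eq_betaIntegral hv hu,
      mul_div_cancel_left₀ _ hne]
  rw [hB, add_comm v u] at h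
  have h2 := intervalIntegral.integral_comp_add_right (a := (-1 : ℝ)) (b := 1)
    (fun x : ℝ => (x : ℂ) ^ (v - 1) * ((2 : ℝ) - x : ℂ) ^ (u - 1)) 1
  norm_num at h h2
  rw [← h, ← h2]
  refine intervalIntegral.integral_congr fun t _ => ?_
  rw [mul_comm, add_comm (1 : ℂ)]
  congr 2
  ring

theorem integral_jacobiWeight {a b : ℝ} (ha : -1 < a) (hb : -1 < b) :
    ∫ t in (-1 : ℝ)..1, (1 - t) ^ a * (1 + t) ^ b =
      2 ^ (a + b + 1) * (Real.Gamma (a + 1) * Real.Gamma (b + 1) / Real.Gamma (a + b + 2)) := by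
  have h := integral_jacobiWeight_complex (u := ((a + 1 : ℝ) : ℂ)) (v := ((b + 1 : ℝ) : ℂ))
    (by simp; linarith) (by simp; linarith)
  have e : (∫ t in (-1 : ℝ)..1, (1 - t : ℂ) ^ (((a + 1 : ℝ) : ℂ) - 1) *
      (1 + t : ℂ) ^ (((b + 1 : ℝ) : ℂ) - 1)) =
      ((∫ t in (-1 : ℝ)..1, (1 - t) ^ a * (1 + t) ^ b : ℝ) : ℂ) := by
    rw [← intervalIntegral.integral_ofReal]
    refine intervalIntegral.integral_congr fun t ht => ?_
    rw [uIcc_of_le (by norm_num)] at ht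
    rw [Complex.ofReal_mul, Complex.ofReal_cpow (by linarith [ht.2]),
      Complex.ofReal_cpow (by linarith [ht.1])]
    push_cast
    simp
  rw [e] at h
  apply Complex.ofReal_injective
  rw [h]
  rw [show a + b + 2 = (a + 1) + (b + 1) by ring]
  simp only [Complex.ofReal_mul, Complex.ofReal_div, Complex.ofReal_cpow (zero_le_two (α := ℝ)),
    ← Complex.Gamma_ofReal]
  push_cast
  ring_nf

theorem integral_jacobiWeight_pos {a b : ℝ} (ha : -1 < a) (hb : -1 < b) :
    0 < ∫ t in (-1 : ℝ)..1, (1 - t) ^ a * (1 + t) ^ b := by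
  rw [integral_jacobiWeight ha hb]
  have h1 := Real.Gamma_pos_of_pos (show 0 < a + 1 by linarith)
  have h2 := Real.Gamma_pos_of_pos (show 0 < b + 1 by linarith)
  have h3 := Real.Gamma_pos_of_pos (show 0 < a + b + 2 by linarith)
  positivity

theorem intervalIntegrable_jacobiWeight_mul {a b : ℝ} (ha : -1 < a) (hb : -1 < b)
    {f : ℝ → ℝ} (hf : Continuous f) :
    IntervalIntegrable (fun t => (1 - t) ^ a * (1 + t) ^ b * f t) volume (-1) 1 :=
  -- the weight is integrable because its integral has a nonzero value
  (intervalIntegral.intervalIntegrable_of_integral_ne_zero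
    (integral_jacobiWeight_pos ha hb).ne').mul_continuousOn hf.continuousOn

theorem Gamma_add_nat {x : ℝ} (hx : 0 < x) (n : ℕ) :
    Real.Gamma (x + n) = Real.Gamma x * (ascPochhammer ℝ n).eval x := by
  induction n with
  | zero => simp
  | succ n ih =>
    rw [ascPochhammer_succ_eval, ← mul_assoc, ← ih, Nat.cast_succ, ← add_assoc,
      Real.Gamma_add_one (by positivity), mul_comm]

/-- The `m`-th finite difference of a polynomial of degree less than `m` vanishes. -/
theorem sum_neg_one_pow_mul_choose_mul_ascPochhammer {n m : ℕ} (h : n < m) (a : ℝ) :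
    ∑ k ∈ Finset.range (m + 1), (-1) ^ k * (m.choose k : ℝ) *
      (ascPochhammer ℝ n).eval (a + k) = 0 := by
  have h1 := congrFun (Polynomial.fwdDiff_iter_eq_zero_of_degree_lt
    (P := ascPochhammer ℝ n) (n := m) (by rwa [ascPochhammer_natDegree])) a
  rw [fwdDiff_iter_eq_sum_shift] at h1
  have h2 := congrArg (fun x => (-1 : ℝ) ^ m * x) h1
  simp only [Pi.zero_apply, mul_zero] at h2
  rw [← h2, Finset.mul_sum]
  refine Finset.sum_congr rfl fun k hk => ?_
  have hk : k ≤ m := by simpa [Nat.lt_succ_iff] using hk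
  obtain ⟨d, rfl⟩ := Nat.exists_eq_add_of_le hk
  simp only [zsmul_eq_mul, nsmul_eq_mul, mul_one, add_tsub_cancel_left]
  push_cast
  rw [pow_add, show ∀ c e : ℝ, (-1 : ℝ) ^ k * (-1) ^ d * ((-1) ^ d * c * e) =
    (-1) ^ k * ((-1) ^ d * (-1) ^ d) * c * e by intros; ring, ← mul_pow]
  norm_num

theorem jacobiPoly_eval (α β : ℝ) (m : ℕ) (t : ℝ) :
    (jacobiPoly α β m).eval t = ∑ k ∈ Finset.range (m + 1),
      ((ascPochhammer ℝ k).eval (α + β + m + 1) *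
        (ascPochhammer ℝ (m - k)).eval (α + k + 1) / (k.factorial * (m - k).factorial)) *
      ((-1) ^ k / 2 ^ k * (1 - t) ^ k) := by
  simp only [jacobiPoly, Polynomial.eval_finsetSum, Polynomial.eval_mul, Polynomial.eval_C,
    Polynomial.eval_pow, Polynomial.eval_sub, Polynomial.eval_X, Polynomial.eval_one]
  refine Finset.sum_congr rfl fun k _ => ?_
  rw [show 1 / 2 * (t - 1) = (-1) / 2 * (1 - t) by ring, mul_pow, div_pow]

/-- The contribution of the `k`-th term of `P_m^{(α,β)}` to
`∫ (1-t)^α (1+t)^(β+j) P_m^{(α,β)}(t) dt` is, up to a factor independent of `k`,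
`(-1)^k (m choose k)` times a polynomial in `k` of degree `m - 1 - j`: the factor `Γ(α+k+1)` of the
beta integral combines with `(α+k+1)_{m-k}` to the constant `Γ(α+m+1)`. -/
theorem jacobi_coeff_identity {α β : ℝ} (hα : -1 < α) (hβ : -1 < β) {m j k : ℕ} (hj : j < m)
    (hk : k ≤ m) :
    ((ascPochhammer ℝ k).eval (α + β + m + 1) *
        (ascPochhammer ℝ (m - k)).eval (α + k + 1) / (k.factorial * (m - k).factorial)) *
      ((-1) ^ k / 2 ^ k * (2 ^ ((α + k) + (β + j) + 1) *
        (Real.Gamma ((α + k) + 1) * Real.Gamma ((β + j) + 1) /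
          Real.Gamma ((α + k) + (β + j) + 2)))) =
    2 ^ (α + β + j + 1) * Real.Gamma (β + j + 1) * Real.Gamma (α + m + 1) /
        (m.factorial * Real.Gamma (α + β + m + 1)) *
      ((-1) ^ k * (m.choose k : ℝ) *
        (ascPochhammer ℝ (m - 1 - j)).eval ((α + β + j + 2) + k)) := by
  obtain ⟨n, rfl⟩ : ∃ n, m = j + 1 + n := Nat.exists_eq_add_of_le hj
  obtain ⟨d, hd⟩ := Nat.exists_eq_add_of_le hk
  have hd' : (j : ℝ) + 1 + n = k + d := by exact_mod_cast hd
  rw [show j + 1 + n - k = d by omega, show j + 1 + n - 1 - j = n by omega]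
  have hj0 : (0 : ℝ) ≤ j := j.cast_nonneg
  have hk0 : (0 : ℝ) ≤ k := k.cast_nonneg
  have hn0 : (0 : ℝ) ≤ n := n.cast_nonneg
  have g1 := Gamma_add_nat (x := α + k + 1) (by linarith) d
  have g2 := Gamma_add_nat (x := α + β + j + 2 + k) (by linarith) n
  have g3 := Gamma_add_nat (x := α + β + j + 2 + n) (by linarith) k
  have p1 := (Real.Gamma_pos_of_pos (show 0 < α + k + 1 by linarith)).ne'
  have p2 := (Real.Gamma_pos_of_pos (show 0 < α + β + j + 2 + k by linarith)).ne'
  have p3 := (Real.Gamma_pos_of_pos (show 0 < α + β + j + 2 + n by linarith)).ne'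
  have hc := congrArg (Nat.cast (R := ℝ)) (Nat.choose_mul_factorial_mul_factorial hk)
  rw [show j + 1 + n - k = d by omega] at hc
  push_cast at hc ⊢
  rw [show α + k + (β + j) + 2 = α + β + j + 2 + k by ring,
    show α + k + (β + j) + 1 = α + β + j + 1 + k by ring, Real.rpow_add_natCast two_ne_zero,
    show α + β + (j + 1 + n) + 1 = α + β + j + 2 + n by ring,
    show α + (j + 1 + n) + 1 = α + k + 1 + d by linarith, g1, ← hc]
  rw [show α + β + j + 2 + n + k = α + β + j + 2 + k + n by ring, g2] at g3
  have f1 : (k.factorial : ℝ) ≠ 0 := by positivity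
  have f2 : (d.factorial : ℝ) ≠ 0 := by positivity
  have f3 : ((j + 1 + n).choose k : ℝ) ≠ 0 := by
    exact_mod_cast (Nat.choose_pos hk).ne'
  field_simp
  linear_combination (-(Real.Gamma (β + j + 1) *
    (ascPochhammer ℝ d).eval (α + k + 1))) * g3

/-- Orthogonality of `P_m^{(α,β)}` to `(1+t)^j`, `j < m`: the integral is an `m`-th finite
difference of a polynomial of degree `m - 1 - j`. -/
theorem integral_jacobiWeight_mul_jacobiPoly_mul_pow {α β : ℝ} (hα : -1 < α) (hβ : -1 < β)
    {m j : ℕ} (hj : j < m) :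
    ∫ t in (-1 : ℝ)..1, (1 - t) ^ α * (1 + t) ^ β *
      ((jacobiPoly α β m).eval t * (1 + t) ^ j) = 0 := by
  have hint : ∀ k : ℕ, IntervalIntegrable
      (fun t : ℝ => (1 - t) ^ (α + k) * (1 + t) ^ (β + j)) volume (-1) 1 := fun k =>
    intervalIntegral.intervalIntegrable_of_integral_ne_zero
      (integral_jacobiWeight_pos (by have := k.cast_nonneg (α := ℝ); linarith)
        (by have := j.cast_nonneg (α := ℝ); linarith)).ne'
  have key : ∫ t in (-1 : ℝ)..1, (1 - t) ^ α * (1 + t) ^ β *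
      ((jacobiPoly α β m).eval t * (1 + t) ^ j) =
      ∫ t in (-1 : ℝ)..1, ∑ k ∈ Finset.range (m + 1),
      ((ascPochhammer ℝ k).eval (α + β + m + 1) *
        (ascPochhammer ℝ (m - k)).eval (α + k + 1) / (k.factorial * (m - k).factorial)) *
      ((-1) ^ k / 2 ^ k * ((1 - t) ^ (α + k) * (1 + t) ^ (β + j))) := by
    rw [intervalIntegral.integral_of_le (by norm_num),
      intervalIntegral.integral_of_le (by norm_num),
      integral_Ioc_eq_integral_Ioo, integral_Ioc_eq_integral_Ioo]
    refine setIntegral_congr_fun measurableSet_Ioo fun t ht => ?_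
    rw [jacobiPoly_eval, Finset.sum_mul, Finset.mul_sum]
    refine Finset.sum_congr rfl fun k _ => ?_
    rw [Real.rpow_add_natCast (by linarith [ht.2]), Real.rpow_add_natCast (by linarith [ht.1])]
    ring
  rw [key, intervalIntegral.integral_finsetSum fun k _ => ((hint k).const_mul _).const_mul _]
  simp only [intervalIntegral.integral_const_mul]
  rw [Finset.sum_congr rfl fun k hk => by
    rw [integral_jacobiWeight (by have := k.cast_nonneg (α := ℝ); linarith)
        (by have := j.cast_nonneg (α := ℝ); linarith),
      jacobi_coeff_identity hα hβ hj (by simpa [Nat.lt_succ_iff] using hk)], ← Finset.mul_sum,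
    sum_neg_one_pow_mul_choose_mul_ascPochhammer (by omega), mul_zero]

theorem integral_jacobiWeight_mul_jacobiPoly_mul {α β : ℝ} (hα : -1 < α) (hβ : -1 < β)
    {m : ℕ} {q : ℝ[X]} (hq : q.natDegree < m) :
    ∫ t in (-1 : ℝ)..1, (1 - t) ^ α * (1 + t) ^ β *
      ((jacobiPoly α β m).eval t * q.eval t) = 0 := by
  have e : ∀ t : ℝ, q.eval t = ∑ j ∈ Finset.range (q.natDegree + 1),
      (Polynomial.taylor (-1) q).coeff j * (1 + t) ^ j := fun t => by
    have := Polynomial.taylor_eval (-1) q (1 + t)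
    rw [show 1 + t + -1 = t by ring] at this
    rw [← this, Polynomial.eval_eq_sum_range, Polynomial.natDegree_taylor]
  simp only [e, Finset.mul_sum]
  rw [intervalIntegral.integral_finsetSum]
  · refine Finset.sum_eq_zero fun j hj => ?_
    have hj : j < m := by have := Finset.mem_range.1 hj; omega
    rw [← mul_zero ((Polynomial.taylor (-1) q).coeff j),
      ← integral_jacobiWeight_mul_jacobiPoly_mul_pow hα hβ hj,
      ← intervalIntegral.integral_const_mul]
    refine intervalIntegral.integral_congr fun t _ => ?_
    ring
  · exact fun j _ => intervalIntegrable_jacobiWeight_mul hα hβ (by fun_prop)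

/-- The leading coefficient contains the factor `(α+β+m+1)_m`, which is `1` for `m = 0` and
positive for `m ≥ 1` because `α + β + m + 1 > m - 1`. -/
theorem degree_jacobiPoly {α β : ℝ} (hα : -1 < α) (hβ : -1 < β) (m : ℕ) :
    (jacobiPoly α β m).degree = m := by
  have hX : ∀ k : ℕ, ((Polynomial.C (1 / 2 : ℝ) * (Polynomial.X - 1)) ^ k).degree =
      (k : WithBot ℕ) := fun k => by
    rw [Polynomial.degree_pow, Polynomial.degree_mul, Polynomial.degree_C (by norm_num),
      ← Polynomial.C_1, Polynomial.degree_X_sub_C]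
    simp
  have hlead : (ascPochhammer ℝ m).eval (α + β + m + 1) ≠ 0 := by
    rcases Nat.eq_zero_or_pos m with rfl | hm
    · simp
    · have : (1 : ℝ) ≤ m := by exact_mod_cast hm
      exact (ascPochhammer_pos _ _ (by linarith)).ne'
  rw [jacobiPoly, Finset.sum_range_succ, Polynomial.degree_add_eq_right_of_degree_lt]
  · rw [Polynomial.degree_mul, Polynomial.degree_C, hX, zero_add]
    simp only [tsub_self, ascPochhammer_zero, Polynomial.eval_one, mul_one]
    exact div_ne_zero hlead (by positivity)
  · rw [Polynomial.degree_mul, Polynomial.degree_C, hX, zero_add]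
    · refine (Polynomial.degree_sum_le _ _).trans_lt ?_
      refine (Finset.sup_lt_iff (WithBot.bot_lt_coe m)).2 fun k hk => ?_
      rw [← Polynomial.smul_eq_C_mul]
      refine (Polynomial.degree_smul_le _ _).trans_lt ?_
      rw [hX]
      exact Nat.cast_lt.2 (Finset.mem_range.1 hk)
    · simp only [tsub_self, ascPochhammer_zero, Polynomial.eval_one, mul_one]
      exact div_ne_zero hlead (by positivity)

theorem jacobiNormSq_pos {α β : ℝ} (hα : -1 < α) (hβ : -1 < β) (m : ℕ) :
    0 < jacobiNormSq α β m := by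
  set P := jacobiPoly α β m
  have hP : P ≠ 0 := by
    intro h
    simpa [P, h] using degree_jacobiPoly hα hβ m
  have hi := intervalIntegrable_jacobiWeight_mul hα hβ (f := fun t => P.eval t ^ 2) (by fun_prop)
  rw [intervalIntegrable_iff_integrableOn_Ioo_of_le (by norm_num)] at hi
  rw [jacobiNormSq, intervalIntegral.integral_of_le (by norm_num), integral_Ioc_eq_integral_Ioo,
    setIntegral_pos_iff_support_of_nonneg_ae _ hi]
  · have hsub : Ioo (-1 : ℝ) 1 \ (P.roots.toFinset : Set ℝ) ⊆
        Function.support (fun t => (1 - t) ^ α * (1 + t) ^ β * P.eval t ^ 2) ∩ Ioo (-1 : ℝ) 1 := by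
      rintro t ⟨ht, hr⟩
      refine ⟨?_, ht⟩
      have : P.eval t ≠ 0 := by simpa [hP] using hr
      have h1 := Real.rpow_pos_of_pos (show 0 < 1 - t by linarith [ht.2]) α
      have h2 := Real.rpow_pos_of_pos (show 0 < 1 + t by linarith [ht.1]) β
      simp only [Function.mem_support]
      positivity
    refine lt_of_lt_of_le ?_ (measure_mono hsub)
    rw [measure_sdiff_null ((Finset.finite_toSet _).measure_zero _)]
    simp
  · refine (ae_restrict_iff' measurableSet_Ioo).2 (Eventually.of_forall fun t ht => ?_)
    have h1 := Real.rpow_nonneg (show 0 ≤ 1 - t by linarith [ht.2]) α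
    have h2 := Real.rpow_nonneg (show 0 ≤ 1 + t by linarith [ht.1]) β
    simp only [Pi.zero_apply]
    positivity

theorem span_range_jacobiPoly {α β : ℝ} (hα : -1 < α) (hβ : -1 < β) :
    Submodule.span ℝ (range (jacobiPoly α β)) = ⊤ := by
  let S : Polynomial.Sequence ℝ := ⟨jacobiPoly α β, degree_jacobiPoly hα hβ⟩
  exact S.span fun i => isUnit_iff_ne_zero.2 (Polynomial.leadingCoeff_ne_zero.2 (S.ne_zero i))

/-! ### Orthonormality and completeness of the tanh-Jacobi functions -/

theorem hasDerivAt_tanh (x : ℝ) : HasDerivAt Real.tanh (1 - Real.tanh x ^ 2) x := by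
  have h := (Real.hasDerivAt_sinh x).div (Real.hasDerivAt_cosh x) (Real.cosh_pos x).ne'
  have hc := (Real.cosh_pos x).ne'
  refine (h.congr_of_eventuallyEq (Eventually.of_forall Real.tanh_eq_sinh_div_cosh)).congr_deriv ?_
  rw [Real.tanh_eq_sinh_div_cosh]
  field_simp

theorem continuous_tanh : Continuous Real.tanh :=
  continuous_iff_continuousAt.2 fun x => (hasDerivAt_tanh x).continuousAt

theorem one_sub_tanh_sq_pos (x : ℝ) : 0 < 1 - Real.tanh x ^ 2 := by
  linarith [Real.tanh_sq_lt_one x]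

theorem one_sub_tanh_pos (x : ℝ) : 0 < 1 - Real.tanh x := by
  linarith [Real.tanh_lt_one x]

theorem one_add_tanh_pos (x : ℝ) : 0 < 1 + Real.tanh x := by
  linarith [Real.neg_one_lt_tanh x]

/-- Substitution `t = tanh x`, `dt = (1 - tanh² x) dx`. -/
theorem integral_comp_tanh {E : Type*} [NormedAddCommGroup E] [NormedSpace ℝ E] (F : ℝ → E) :
    ∫ x, (1 - Real.tanh x ^ 2) • F (Real.tanh x) = ∫ t in (-1 : ℝ)..1, F t := by
  have h := integral_image_eq_integral_abs_deriv_smul MeasurableSet.univ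
    (fun x _ => (hasDerivAt_tanh x).hasDerivWithinAt) Real.tanh_injective.injOn F
  rw [Real.tanh_bijOn.image_eq, Measure.restrict_univ] at h
  rw [intervalIntegral.integral_of_le (by norm_num), integral_Ioc_eq_integral_Ioo, h]
  simp only [abs_of_pos (one_sub_tanh_sq_pos _)]

theorem continuous_phi (α β : ℝ) (m : ℕ) : Continuous (phi α β m) := by
  have h := continuous_tanh
  unfold phi
  exact ((continuous_const.mul (Continuous.rpow_const (by fun_prop) fun x =>
    Or.inl (one_sub_tanh_pos x).ne')).mul (Continuous.rpow_const (by fun_prop) fun x =>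
      Or.inl (one_add_tanh_pos x).ne')).mul (by fun_prop)

/-- The factor `1 - tanh² x` split off here is the Jacobian of `t = tanh x`; what remains is the
integrand of the orthogonality relation of the Jacobi polynomials. -/
theorem phi_mul_phi (α β : ℝ) (m n : ℕ) (x : ℝ) :
    phi α β m x * phi α β n x = (1 - Real.tanh x ^ 2) •
      ((-1) ^ m / √(jacobiNormSq α β m) * ((-1) ^ n / √(jacobiNormSq α β n)) *
        ((1 - Real.tanh x) ^ α * (1 + Real.tanh x) ^ β *
          ((jacobiPoly α β m).eval (Real.tanh x) * (jacobiPoly α β n).eval (Real.tanh x)))) := by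
  have e : ∀ {y : ℝ}, 0 < y → ∀ a : ℝ, y ^ ((a + 1) / 2) * y ^ ((a + 1) / 2) = y ^ a * y := by
    intro y hy a
    rw [← Real.rpow_add hy, add_halves, Real.rpow_add hy, Real.rpow_one]
  have e1 := e (one_sub_tanh_pos x) α
  have e2 := e (one_add_tanh_pos x) β
  simp only [phi, smul_eq_mul]
  set A := (1 - Real.tanh x) ^ ((α + 1) / 2)
  set B := (1 + Real.tanh x) ^ ((β + 1) / 2)
  calc _ = (-1) ^ m / √(jacobiNormSq α β m) * ((-1) ^ n / √(jacobiNormSq α β n)) * (A * A) *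
        (B * B) * ((jacobiPoly α β m).eval (Real.tanh x) *
          (jacobiPoly α β n).eval (Real.tanh x)) := by ring
    _ = _ := by rw [e1, e2]; ring

theorem integral_phi_mul_phi {α β : ℝ} (hα : -1 < α) (hβ : -1 < β) (m n : ℕ) :
    ∫ x, phi α β m x * phi α β n x = if m = n then 1 else 0 := by
  simp only [phi_mul_phi]
  rw [integral_comp_tanh (fun t => (-1) ^ m / √(jacobiNormSq α β m) *
    ((-1) ^ n / √(jacobiNormSq α β n)) * ((1 - t) ^ α * (1 + t) ^ β *
          ((jacobiPoly α β m).eval t * (jacobiPoly α β n).eval t))),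
    intervalIntegral.integral_const_mul]
  split_ifs with h
  · subst h
    have hg := jacobiNormSq_pos hα hβ m
    have : (∫ t in (-1 : ℝ)..1, (1 - t) ^ α * (1 + t) ^ β *
        ((jacobiPoly α β m).eval t * (jacobiPoly α β m).eval t)) = jacobiNormSq α β m := by
      simp only [jacobiNormSq, pow_two]
    rw [this, div_mul_div_comm, Real.mul_self_sqrt hg.le, ← mul_pow]
    field_simp
    norm_num
  · rcases lt_or_gt_of_ne h with h | h
    · simp only [mul_comm ((jacobiPoly α β m).eval _)]
      rw [integral_jacobiWeight_mul_jacobiPoly_mul hα hβ, mul_zero]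
      rwa [Polynomial.natDegree_eq_of_degree_eq_some (degree_jacobiPoly hα hβ m)]
    · rw [integral_jacobiWeight_mul_jacobiPoly_mul hα hβ, mul_zero]
      rwa [Polynomial.natDegree_eq_of_degree_eq_some (degree_jacobiPoly hα hβ n)]

theorem memLp_phi {α β : ℝ} (hα : -1 < α) (hβ : -1 < β) (m : ℕ) :
    MemLp (phi α β m) 2 volume := by
  rw [memLp_two_iff_integrable_sq (continuous_phi α β m).aestronglyMeasurable]
  -- the integral of a non-integrable function would be `0`, but this one is `1`
  refine Integrable.of_integral_ne_zero ?_
  simp only [pow_two]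
  simp [integral_phi_mul_phi hα hβ]

theorem orthonormal_phi {𝕜 : Type*} [RCLike 𝕜] {α β : ℝ} (hα : -1 < α) (hβ : -1 < β)
    (hφ : ∀ m : ℕ, MemLp (fun x : ℝ => (phi α β m x : 𝕜)) 2 volume) :
    Orthonormal 𝕜 (fun m : ℕ => (hφ m).toLp) := by
  rw [orthonormal_iff_ite]
  intro m n
  have : ∫ x, inner 𝕜 ((hφ m).toLp _ x) ((hφ n).toLp _ x) =
      ((∫ x, phi α β m x * phi α β n x : ℝ) : 𝕜) := by
    rw [← integral_ofReal]
    refine integral_congr_ae ?_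
    filter_upwards [(hφ m).coeFn_toLp, (hφ n).coeFn_toLp] with x h1 h2
    rw [h1, h2, RCLike.inner_apply, RCLike.conj_ofReal, RCLike.ofReal_mul, mul_comm]
  rw [L2.inner_def, this, integral_phi_mul_phi hα hβ]
  split_ifs <;> simp

/-- Completeness of a real-valued system over either scalar field can be tested on real-valued
functions. -/
theorem topologicalClosure_span_eq_top_of_forall_real {𝕜 ι : Type*} [RCLike 𝕜] {μ : Measure ℝ}
    {e : ι → ℝ → ℝ} (he : ∀ i, MemLp (fun x => (e i x : 𝕜)) 2 μ)
    (H : ∀ f : ℝ → ℝ, MemLp f 2 μ → (∀ i, ∫ x, e i x * f x ∂μ = 0) → f =ᵐ[μ] 0) :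
    (Submodule.span 𝕜 (range fun i => (he i).toLp)).topologicalClosure = ⊤ := by
  rw [Submodule.topologicalClosure_eq_top_iff, Submodule.eq_bot_iff]
  intro f hf
  have hf2 : MemLp f 2 μ := Lp.memLp f
  have hfe : ∀ i, Integrable (fun x => (e i x : 𝕜) * f x) μ := fun i =>
    (he i).integrable_mul hf2
  have hz : ∀ i, ∫ x, (e i x : 𝕜) * f x ∂μ = 0 := by
    intro i
    have h := (Submodule.mem_orthogonal _ _).1 hf _ (Submodule.subset_span (mem_range_self i))
    rw [L2.inner_def] at h
    rw [← h]
    refine integral_congr_ae ?_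
    filter_upwards [(he i).coeFn_toLp] with x hx
    rw [hx, RCLike.inner_apply, RCLike.conj_ofReal, mul_comm]
  have hre := H _ hf2.re fun i => by
    have := integral_re (hfe i)
    rw [hz i] at this
    simpa only [RCLike.re_ofReal_mul, map_zero] using this
  have him := H _ hf2.im fun i => by
    have := integral_im (hfe i)
    rw [hz i] at this
    simpa only [RCLike.im_ofReal_mul, map_zero] using this
  rw [Lp.eq_zero_iff_ae_eq_zero]
  filter_upwards [hre, him] with x h1 h2
  exact RCLike.ext (by simpa using h1) (by simpa using h2)

theorem integrable_comp_tanh_mul {h : ℝ → ℝ} (hh : Integrable h) {G : ℝ → ℝ}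
    (hG : ContinuousOn G (Icc (-1) 1)) : Integrable fun x => G (Real.tanh x) * h x := by
  have hmem : ∀ x, Real.tanh x ∈ Icc (-1 : ℝ) 1 := fun x =>
    ⟨(Real.neg_one_lt_tanh x).le, (Real.tanh_lt_one x).le⟩
  obtain ⟨M, hM⟩ := isCompact_Icc.exists_bound_of_continuousOn hG
  exact hh.bdd_mul (hG.comp_continuous continuous_tanh hmem).aestronglyMeasurable
    (Eventually.of_forall fun x => hM _ (hmem x))

/-- By the Weierstrass theorem, vanishing of the integrals against polynomials in `tanh x` extends
to continuous functions of `tanh x`. -/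
theorem integral_comp_tanh_mul_eq_zero {h : ℝ → ℝ} (hh : Integrable h)
    (H : ∀ p : ℝ[X], ∫ x, p.eval (Real.tanh x) * h x = 0)
    {G : ℝ → ℝ} (hG : ContinuousOn G (Icc (-1) 1)) :
    ∫ x, G (Real.tanh x) * h x = 0 := by
  by_contra hne
  have hpos : 0 < |∫ x, G (Real.tanh x) * h x| := abs_pos.2 hne
  set I := |∫ x, G (Real.tanh x) * h x| with hI
  have hN : 0 ≤ ∫ x, ‖h x‖ := integral_nonneg fun x => norm_nonneg _
  set N := ∫ x, ‖h x‖
  obtain ⟨p, hp⟩ := exists_polynomial_near_of_continuousOn (-1) 1 G hG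
    (I / (N + 1)) (by positivity)
  have key : I ≤ I / (N + 1) * N := by
    calc I = ‖∫ x, (G (Real.tanh x) * h x - p.eval (Real.tanh x) * h x)‖ := by
          rw [integral_sub (integrable_comp_tanh_mul hh hG)
            (integrable_comp_tanh_mul hh (G := fun t => p.eval t) (by fun_prop)), H p, sub_zero,
            hI, Real.norm_eq_abs]
      _ ≤ ∫ x, I / (N + 1) * ‖h x‖ := by
          refine norm_integral_le_of_norm_le (hh.norm.const_mul _)
            (Eventually.of_forall fun x => ?_)
          rw [← sub_mul, norm_mul, norm_sub_rev]
          exact mul_le_mul_of_nonneg_right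
            (hp _ ⟨(Real.neg_one_lt_tanh x).le, (Real.tanh_lt_one x).le⟩).le (norm_nonneg _)
      _ = _ := integral_const_mul _ _
  have : I / (N + 1) * N < I := by
    rw [div_mul_eq_mul_div, div_lt_iff₀ (by positivity)]
    linarith [mul_add I N 1]
  linarith

theorem continuousOn_artanh : ContinuousOn Real.artanh (Ioo (-1) 1) := by
  unfold Real.artanh
  refine ContinuousOn.log (ContinuousOn.sqrt (ContinuousOn.div (by fun_prop) (by fun_prop) ?_)) ?_
  · intro x hx h; linarith [hx.2]
  · intro x hx
    have h1 : 0 < 1 + x := by linarith [hx.1]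
    have h2 : 0 < 1 - x := by linarith [hx.2]
    positivity

theorem ae_eq_zero_of_integral_polynomial_tanh_mul_eq_zero {h : ℝ → ℝ} (hh : Integrable h)
    (H : ∀ p : ℝ[X], ∫ x, p.eval (Real.tanh x) * h x = 0) : h =ᵐ[volume] 0 := by
  refine ae_eq_zero_of_integral_contDiff_smul_eq_zero hh.locallyIntegrable fun ψ hψ hc => ?_
  obtain ⟨R, hR⟩ := hc.isCompact.isBounded.subset_closedBall 0
  have hz : ∀ x, |R| < |x| → ψ x = 0 := fun x hx => by
    by_contra hne
    have := hR (subset_tsupport ψ hne)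
    rw [mem_closedBall_zero_iff, Real.norm_eq_abs] at this
    linarith [le_abs_self R]
  -- `ψ ∘ artanh` extends continuously to `[-1, 1]`: clamping the argument to a compact part of
  -- `(-1, 1)` changes it only where `ψ` vanishes.
  obtain ⟨S, hRS⟩ : ∃ S, |R| < S := ⟨|R| + 1, by linarith⟩
  have hS : 0 < S := (abs_nonneg R).trans_lt hRS
  have hmono : Monotone Real.tanh :=
    (strictMono_of_hasDerivAt_pos hasDerivAt_tanh one_sub_tanh_sq_pos).monotone
  set c : ℝ → ℝ := fun t => max (Real.tanh (-S)) (min t (Real.tanh S))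
  have hc : ∀ x, c (Real.tanh x) = Real.tanh (max (-S) (min x S)) := fun x => by
    simp only [c, hmono.map_max, hmono.map_min]
  have hG : Continuous fun t => ψ (Real.artanh (c t)) := by
    refine hψ.continuous.comp (continuousOn_artanh.comp_continuous (by fun_prop) fun t => ?_)
    exact ⟨lt_of_lt_of_le (Real.neg_one_lt_tanh _) (le_max_left _ _),
      lt_of_le_of_lt (max_le (hmono (by linarith)) (min_le_right _ _)) (Real.tanh_lt_one S)⟩
  rw [← integral_comp_tanh_mul_eq_zero hh H hG.continuousOn]
  refine integral_congr_ae (Eventually.of_forall fun x => ?_)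
  simp only [smul_eq_mul, hc, Real.artanh_tanh]
  congr 1
  rcases le_total x S with h1 | h1
  · rcases le_total (-S) x with h2 | h2
    · rw [min_eq_left h1, max_eq_right h2]
    · rw [min_eq_left h1, max_eq_left h2, hz, hz]
      · rwa [abs_neg, abs_of_pos hS]
      · rw [abs_of_nonpos (a := x) (by linarith)]; linarith
  · rw [min_eq_right h1, max_eq_right (by linarith), hz, hz]
    · rwa [abs_of_pos hS]
    · rw [abs_of_nonneg (a := x) (by linarith)]; linarith

theorem ae_eq_zero_of_integral_phi_mul_eq_zero {α β : ℝ} (hα : -1 < α) (hβ : -1 < β) {f : ℝ → ℝ}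
    (hf : MemLp f 2 volume) (H : ∀ m, ∫ x, phi α β m x * f x = 0) : f =ᵐ[volume] 0 := by
  set v : ℝ → ℝ := fun x => (1 - Real.tanh x) ^ ((α + 1) / 2) * (1 + Real.tanh x) ^ ((β + 1) / 2)
  have hφ : ∀ m x, phi α β m x * f x = (-1) ^ m / √(jacobiNormSq α β m) *
      ((jacobiPoly α β m).eval (Real.tanh x) * (v x * f x)) := fun m x => by
    simp only [phi, v]; ring
  have hd : ∀ m, (-1) ^ m / √(jacobiNormSq α β m) ≠ 0 := fun m =>
    div_ne_zero (by simp) (Real.sqrt_pos.2 (jacobiNormSq_pos hα hβ m)).ne'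
  have hv : Integrable fun x => v x * f x := by
    have h0 : Integrable fun x => phi α β 0 x * f x := (memLp_phi hα hβ 0).integrable_mul hf
    simp only [hφ] at h0
    rw [integrable_const_mul_iff (isUnit_iff_ne_zero.2 (hd 0))] at h0
    simpa [jacobiPoly] using h0
  have hp : ∀ p : ℝ[X], ∫ x, p.eval (Real.tanh x) * (v x * f x) = 0 := fun p => by
    have hmem : p ∈ Submodule.span ℝ (range (jacobiPoly α β)) := by
      rw [span_range_jacobiPoly hα hβ]; trivial
    induction hmem using Submodule.span_induction with
    | mem q hq =>
      obtain ⟨m, rfl⟩ := hq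
      have := H m
      simp only [hφ, integral_const_mul] at this
      exact (mul_eq_zero.1 this).resolve_left (hd m)
    | zero => simp
    | add q r _ _ hq hr =>
      simp only [Polynomial.eval_add, add_mul]
      rw [integral_add (integrable_comp_tanh_mul hv (G := fun t => q.eval t) (by fun_prop))
        (integrable_comp_tanh_mul hv (G := fun t => r.eval t) (by fun_prop)), hq, hr, add_zero]
    | smul a q _ hq =>
      simp only [Polynomial.eval_smul, smul_eq_mul, mul_assoc, integral_const_mul, hq, mul_zero]
  filter_upwards [ae_eq_zero_of_integral_polynomial_tanh_mul_eq_zero hv hp] with x hx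
  have h1 := Real.rpow_pos_of_pos (one_sub_tanh_pos x) ((α + 1) / 2)
  have h2 := Real.rpow_pos_of_pos (one_add_tanh_pos x) ((β + 1) / 2)
  exact (mul_eq_zero.1 hx).resolve_left (mul_pos h1 h2).ne'

/-! ### The modulus of the Gamma function on vertical lines -/

/-- Euler's reflection formula on the line `Re s = 1/2`, where `1 - s` is the conjugate of `s`. -/
theorem norm_Gamma_half_add_mul_I_sq (y : ℝ) :
    ‖Complex.Gamma ((1 / 2 : ℝ) + y * Complex.I)‖ ^ 2 = Real.pi / Real.cosh (Real.pi * y) := by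
  have h := Complex.Gamma_mul_Gamma_one_sub ((1 / 2 : ℝ) + y * Complex.I)
  have hc : (1 : ℂ) - ((1 / 2 : ℝ) + y * Complex.I) =
      (starRingEnd ℂ) ((1 / 2 : ℝ) + y * Complex.I) := by
    simp only [map_add, map_mul, Complex.conj_ofReal, Complex.conj_I]
    push_cast
    ring
  have hs : Complex.sin (Real.pi * ((1 / 2 : ℝ) + y * Complex.I)) =
      (Real.cosh (Real.pi * y) : ℝ) := by
    rw [show (Real.pi : ℂ) * ((1 / 2 : ℝ) + y * Complex.I) =
      (Real.pi * y : ℝ) * Complex.I + Real.pi / 2 by push_cast; ring, Complex.sin_add_pi_div_two,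
      Complex.cos_mul_I, Complex.ofReal_cosh]
  rw [hc, Complex.Gamma_conj, Complex.mul_conj', hs] at h
  exact_mod_cast h

theorem norm_GammaSeq_sq {σ y : ℝ} {n : ℕ} (hn : 0 < n) :
    ‖Complex.GammaSeq (σ + y * Complex.I) n‖ ^ 2 =
      (n : ℝ) ^ (2 * σ) * (n.factorial : ℝ) ^ 2 /
        ∏ j ∈ Finset.range (n + 1), ((j + σ) ^ 2 + y ^ 2) := by
  have hn' : (0 : ℝ) < n := by exact_mod_cast hn
  have h1 : ‖(n : ℂ) ^ ((σ : ℂ) + y * Complex.I)‖ = (n : ℝ) ^ σ := by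
    rw [← Complex.ofReal_natCast, Complex.norm_cpow_eq_rpow_re_of_pos hn']
    simp
  rw [Complex.GammaSeq, norm_div, norm_mul, h1, Complex.norm_natCast, norm_prod, div_pow, mul_pow,
    ← Finset.prod_pow, mul_comm 2 σ, Real.rpow_mul hn'.le, Real.rpow_two]
  congr 1
  refine Finset.prod_congr rfl fun j _ => ?_
  rw [Complex.sq_norm, Complex.normSq_apply]
  simp
  ring

/-- The function `u ↦ log ((x + u)² + y²)` is, up to an error `O(1 / (x² + y²))`, affine on bounded
intervals. -/
theorem abs_log_sub_log_sub_mul_le {σ x y : ℝ} (hσ : 0 < σ) (hx : 0 ≤ x) (hy : 0 < y) :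
    |Real.log ((x + σ) ^ 2 + y ^ 2) - Real.log ((x + 1 / 2) ^ 2 + y ^ 2) -
      (σ - 1 / 2) * (Real.log ((x + 1) ^ 2 + y ^ 2) - Real.log (x ^ 2 + y ^ 2))| ≤
      4 * (σ + 1) * |σ - 1 / 2| * (1 / (x ^ 2 + y ^ 2)) := by
  have hpos : ∀ u : ℝ, 0 < u ^ 2 + y ^ 2 := fun u => by positivity
  set A := 2 * x / (x ^ 2 + y ^ 2)
  set F : ℝ → ℝ := fun u => Real.log ((x + u) ^ 2 + y ^ 2) - A * u with hF
  set B := 2 * (σ + 1) * (1 / (x ^ 2 + y ^ 2)) with hB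
  have hd : ∀ u, HasDerivAt F (2 * (x + u) / ((x + u) ^ 2 + y ^ 2) - A) u := fun u => by
    have h1 : HasDerivAt (fun u => (x + u) ^ 2 + y ^ 2) (2 * (x + u)) u := by
      simpa using (((hasDerivAt_id u).const_add x).pow 2).add_const (y ^ 2)
    exact (h1.log (hpos _).ne').sub (by simpa using (hasDerivAt_id u).const_mul A)
  have hb : ∀ u ∈ Icc 0 (σ + 1), ‖2 * (x + u) / ((x + u) ^ 2 + y ^ 2) - A‖ ≤ B := by
    intro u hu
    have e : 2 * (x + u) / ((x + u) ^ 2 + y ^ 2) - A =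
        2 * u * (1 / (x ^ 2 + y ^ 2)) * ((y ^ 2 - (x + u) * x) / ((x + u) ^ 2 + y ^ 2)) := by
      simp only [A]
      field_simp [(hpos x).ne', (hpos (x + u)).ne']
      ring
    have hu0 := hu.1
    have h1 : |(y ^ 2 - (x + u) * x) / ((x + u) ^ 2 + y ^ 2)| ≤ 1 := by
      rw [abs_div, abs_of_pos (hpos (x + u)), div_le_one (hpos _), abs_le]
      constructor
      · nlinarith [mul_nonneg hu0 hx, mul_nonneg hu0 hu0, sq_nonneg y]
      · nlinarith [mul_nonneg hu0 hx, mul_nonneg hu0 hu0, sq_nonneg x]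
    rw [e, Real.norm_eq_abs, abs_mul, abs_of_nonneg (a := 2 * u * (1 / (x ^ 2 + y ^ 2)))
      (by positivity)]
    calc _ ≤ 2 * u * (1 / (x ^ 2 + y ^ 2)) * 1 := by gcongr
      _ ≤ B := by
        rw [mul_one, hB]
        have := hu.2
        gcongr
  have hL : ∀ u ∈ Icc 0 (σ + 1), ∀ v ∈ Icc 0 (σ + 1), |F u - F v| ≤ B * |u - v| :=
    fun u hu v hv => (convex_Icc 0 (σ + 1)).norm_image_sub_le_of_norm_hasDerivWithin_le
      (fun w _ => (hd w).hasDerivWithinAt) hb hv hu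
  have h1 := hL σ ⟨hσ.le, by linarith⟩ (1 / 2) ⟨by norm_num, by linarith⟩
  have h2 := hL 1 ⟨by norm_num, by linarith⟩ 0 ⟨le_rfl, by linarith⟩
  have e : Real.log ((x + σ) ^ 2 + y ^ 2) - Real.log ((x + 1 / 2) ^ 2 + y ^ 2) -
      (σ - 1 / 2) * (Real.log ((x + 1) ^ 2 + y ^ 2) - Real.log (x ^ 2 + y ^ 2)) =
      (F σ - F (1 / 2)) - (σ - 1 / 2) * (F 1 - F 0) := by
    simp only [hF, add_zero]
    ring
  rw [sub_zero, abs_one, mul_one] at h2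
  rw [e]
  calc _ ≤ |F σ - F (1 / 2)| + |(σ - 1 / 2) * (F 1 - F 0)| := abs_sub _ _
    _ ≤ B * |σ - 1 / 2| + |σ - 1 / 2| * B := by
      rw [abs_mul]
      gcongr
    _ = _ := by rw [hB]; ring

theorem summable_one_div_nat_sq_add_sq {y : ℝ} (hy : 1 ≤ y) :
    Summable fun j : ℕ => 1 / ((j : ℝ) ^ 2 + y ^ 2) := by
  have h : Summable fun j : ℕ => 2 * (1 / ((j + 1 : ℕ) : ℝ) ^ 2) :=
    ((summable_nat_add_iff 1).2 (Real.summable_one_div_nat_pow.2 one_lt_two)).mul_left 2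
  refine Summable.of_nonneg_of_le (fun j => by positivity) (fun j => ?_) h
  rw [← div_eq_mul_one_div, div_le_div_iff₀ (by positivity) (by positivity)]
  push_cast
  nlinarith [sq_nonneg ((j : ℝ) - 1)]

theorem tendsto_tsum_one_div_nat_sq_add_sq :
    Tendsto (fun y : ℝ => ∑' j : ℕ, 1 / ((j : ℝ) ^ 2 + y ^ 2)) atTop (𝓝 0) := by
  have h := tendsto_tsum_of_dominated_convergence (𝓕 := (atTop : Filter ℝ))
    (f := fun (y : ℝ) (j : ℕ) => 1 / ((j : ℝ) ^ 2 + y ^ 2)) (g := fun _ => (0 : ℝ))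
    (summable_one_div_nat_sq_add_sq le_rfl) (fun j => ?_) ?_
  · simpa using h
  · exact tendsto_const_nhds.div_atTop
      (tendsto_atTop_add_const_left _ _ (tendsto_pow_atTop two_ne_zero))
  · filter_upwards [eventually_ge_atTop 1] with y hy j
    rw [Real.norm_of_nonneg (by positivity)]
    gcongr

theorem ofReal_add_mul_I_Gamma_ne_zero {σ : ℝ} (hσ : 0 < σ) (y : ℝ) :
    Complex.Gamma (σ + y * Complex.I) ≠ 0 :=
  Complex.Gamma_ne_zero_of_re_pos (by simpa)

/-- Comparison of the modulus of `Γ` on the lines `Re s = σ` and `Re s = 1/2`. In Euler's limit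
formula, the logarithm of the quotient is, up to sign and a power of `n`, a sum of differences
`ℓ(j + σ) - ℓ(j + 1/2)` with `ℓ(u) = log (u² + y²)`. Each is `(σ - 1/2) (ℓ(j + 1) - ℓ(j))` up to
`O(1 / (j² + y²))`, and these main terms telescope. -/
theorem abs_log_norm_Gamma_sq_sub_le {σ y : ℝ} (hσ : 0 < σ) (hy : 1 ≤ y) :
    |Real.log (‖Complex.Gamma (σ + y * Complex.I)‖ ^ 2) -
      Real.log (‖Complex.Gamma ((1 / 2 : ℝ) + y * Complex.I)‖ ^ 2) - (2 * σ - 1) * Real.log y| ≤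
      4 * (σ + 1) * |σ - 1 / 2| * ∑' j : ℕ, 1 / ((j : ℝ) ^ 2 + y ^ 2) := by
  have hy0 : 0 < y := by linarith
  set ℓ : ℝ → ℝ := fun u => Real.log (u ^ 2 + y ^ 2) with hℓ
  have hpos : ∀ u : ℝ, u ^ 2 + y ^ 2 ≠ 0 := fun u => by positivity
  have hlim : ∀ τ : ℝ, 0 < τ → Tendsto
      (fun n => Real.log (‖Complex.GammaSeq (τ + y * Complex.I) n‖ ^ 2)) atTop
      (𝓝 (Real.log (‖Complex.Gamma (τ + y * Complex.I)‖ ^ 2))) := fun τ hτ =>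
    ((Complex.GammaSeq_tendsto_Gamma _).norm.pow 2).log
      (pow_ne_zero 2 (norm_ne_zero_iff.2 (ofReal_add_mul_I_Gamma_ne_zero hτ y)))
  have hlog : ∀ τ : ℝ, ∀ n : ℕ, 0 < n →
      Real.log (‖Complex.GammaSeq (τ + y * Complex.I) n‖ ^ 2) =
        2 * τ * Real.log n + Real.log ((n.factorial : ℝ) ^ 2) -
          ∑ j ∈ Finset.range (n + 1), ℓ (j + τ) := by
    intro τ n hn
    have hn' : (0 : ℝ) < n := by exact_mod_cast hn
    rw [norm_GammaSeq_sq hn, Real.log_div (by positivity)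
      (Finset.prod_ne_zero_iff.2 fun j _ => hpos _), Real.log_mul (by positivity) (by positivity),
      Real.log_rpow hn', Real.log_prod fun j _ => hpos _]
  -- the boundary term of the telescoping sum
  have hbd : Tendsto (fun n : ℕ => (σ - 1 / 2) * (2 * Real.log n - ℓ (n + 1))) atTop (𝓝 0) := by
    have h1 : Tendsto (fun n : ℕ => Real.log ((((n : ℝ) + 1) / n) ^ 2 + y ^ 2 / (n : ℝ) ^ 2)) atTop
        (𝓝 (Real.log (1 ^ 2 + 0))) := by
      refine Tendsto.log (Tendsto.add (Tendsto.pow ?_ 2) ?_) (by norm_num)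
      · have : Tendsto (fun n : ℕ => 1 + 1 / (n : ℝ)) atTop (𝓝 (1 + 0)) :=
          tendsto_const_nhds.add tendsto_one_div_atTop_nhds_zero_nat
        rw [add_zero] at this
        refine this.congr' ?_
        filter_upwards [eventually_gt_atTop 0] with n hn
        have : (0 : ℝ) < n := by exact_mod_cast hn
        field_simp
      · exact tendsto_const_nhds.div_atTop
          ((tendsto_pow_atTop two_ne_zero).comp tendsto_natCast_atTop_atTop)
    have h2 := (h1.neg).const_mul (σ - 1 / 2)
    norm_num at h2
    refine h2.congr' ?_
    filter_upwards [eventually_gt_atTop 0] with n hn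
    have hn' : (0 : ℝ) < n := by exact_mod_cast hn
    rw [div_pow, ← add_div, Real.log_div (hpos _) (by positivity), Real.log_pow]
    simp only [hℓ]
    push_cast
    ring
  have hconv : Tendsto (fun n => |Real.log (‖Complex.GammaSeq (σ + y * Complex.I) n‖ ^ 2) -
      Real.log (‖Complex.GammaSeq ((1 / 2 : ℝ) + y * Complex.I) n‖ ^ 2) -
      (2 * σ - 1) * Real.log y - (σ - 1 / 2) * (2 * Real.log n - ℓ (n + 1))|) atTop
      (𝓝 (|Real.log (‖Complex.Gamma (σ + y * Complex.I)‖ ^ 2) -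
      Real.log (‖Complex.Gamma ((1 / 2 : ℝ) + y * Complex.I)‖ ^ 2) -
      (2 * σ - 1) * Real.log y - 0|)) :=
    ((((hlim σ hσ).sub (hlim (1 / 2) (by norm_num))).sub_const _).sub hbd).abs
  rw [sub_zero] at hconv
  refine le_of_tendsto hconv ?_
  filter_upwards [eventually_gt_atTop 0] with n hn
  have htel : ∑ j ∈ Finset.range (n + 1), (ℓ ((j : ℝ) + 1) - ℓ j) = ℓ (n + 1) - 2 * Real.log y := by
    have := Finset.sum_range_sub (fun j : ℕ => ℓ j) (n + 1)
    push_cast at this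
    rw [this]
    simp only [hℓ]
    rw [show ((0 : ℝ)) ^ 2 + y ^ 2 = y ^ 2 by ring, Real.log_pow]
    norm_num
  have e : Real.log (‖Complex.GammaSeq (σ + y * Complex.I) n‖ ^ 2) -
      Real.log (‖Complex.GammaSeq ((1 / 2 : ℝ) + y * Complex.I) n‖ ^ 2) -
      (2 * σ - 1) * Real.log y - (σ - 1 / 2) * (2 * Real.log n - ℓ (n + 1)) =
      - ∑ j ∈ Finset.range (n + 1), (ℓ (j + σ) - ℓ (j + 1 / 2) -
        (σ - 1 / 2) * (ℓ ((j : ℝ) + 1) - ℓ j)) := by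
    rw [hlog _ n hn, hlog _ n hn, Finset.sum_sub_distrib, Finset.sum_sub_distrib,
      ← Finset.mul_sum, htel]
    ring
  rw [e, abs_neg]
  calc _ ≤ ∑ j ∈ Finset.range (n + 1), 4 * (σ + 1) * |σ - 1 / 2| * (1 / ((j : ℝ) ^ 2 + y ^ 2)) :=
        (Finset.abs_sum_le_sum_abs _ _).trans (Finset.sum_le_sum fun j _ =>
          abs_log_sub_log_sub_mul_le hσ j.cast_nonneg hy0)
    _ ≤ _ := by
        rw [← Finset.mul_sum]
        refine mul_le_mul_of_nonneg_left ?_ (by positivity)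
        exact (summable_one_div_nat_sq_add_sq hy).sum_le_tsum _ fun j _ => by positivity

/-- Stirling's formula for the modulus of the Gamma function on a vertical line. -/
theorem isEquivalent_norm_Gamma_sq_atTop {σ : ℝ} (hσ : 0 < σ) :
    Asymptotics.IsEquivalent atTop
      (fun y : ℝ => ‖Complex.Gamma (σ + y * Complex.I)‖ ^ 2)
      (fun y : ℝ => 2 * Real.pi * y ^ (2 * σ - 1) * Real.exp (-(Real.pi * y))) := by
  have h1 : Tendsto (fun y : ℝ => Real.log (‖Complex.Gamma (σ + y * Complex.I)‖ ^ 2) -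
      Real.log (‖Complex.Gamma ((1 / 2 : ℝ) + y * Complex.I)‖ ^ 2) - (2 * σ - 1) * Real.log y)
      atTop (𝓝 0) := by
    have := tendsto_tsum_one_div_nat_sq_add_sq.const_mul (4 * (σ + 1) * |σ - 1 / 2|)
    rw [mul_zero] at this
    refine squeeze_zero_norm' ?_ this
    filter_upwards [eventually_ge_atTop 1] with y hy
    exact abs_log_norm_Gamma_sq_sub_le hσ hy
  have h2 : Tendsto (fun y : ℝ => (1 + Real.exp (-(2 * Real.pi * y)))⁻¹) atTop (𝓝 1) := by
    have : Tendsto (fun y : ℝ => Real.exp (-(2 * Real.pi * y))) atTop (𝓝 0) :=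
      Real.tendsto_exp_neg_atTop_nhds_zero.comp
        (tendsto_id.const_mul_atTop (by positivity : 0 < 2 * Real.pi))
    simpa using (this.const_add 1).inv₀ (by norm_num)
  have h3 := ((Real.continuous_exp.tendsto _).comp h1).mul h2
  rw [Real.exp_zero, mul_one] at h3
  refine Asymptotics.isEquivalent_of_tendsto_one (h3.congr' ?_)
  filter_upwards [eventually_gt_atTop 0] with y hy
  have p1 : 0 < ‖Complex.Gamma (σ + y * Complex.I)‖ ^ 2 :=
    pow_pos (norm_pos_iff.2 (ofReal_add_mul_I_Gamma_ne_zero hσ y)) 2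
  have p2 : 0 < ‖Complex.Gamma ((1 / 2 : ℝ) + y * Complex.I)‖ ^ 2 :=
    pow_pos (norm_pos_iff.2 (ofReal_add_mul_I_Gamma_ne_zero (by norm_num) y)) 2
  simp only [Function.comp_apply, Pi.div_apply]
  rw [Real.exp_sub, Real.exp_sub, Real.exp_log p1, Real.exp_log p2, mul_comm _ (Real.log y),
    ← Real.rpow_def_of_pos hy, norm_Gamma_half_add_mul_I_sq, Real.cosh_eq,
    show -(2 * Real.pi * y) = -(Real.pi * y) - Real.pi * y by ring, Real.exp_sub, Real.exp_neg]
  have := Real.exp_pos (Real.pi * y)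
  have := Real.rpow_pos_of_pos hy (2 * σ - 1)
  have := Real.pi_pos
  field_simp

theorem isEquivalent_norm_Gamma_sq {σ : ℝ} (hσ : 0 < σ) :
    Asymptotics.IsEquivalent (cocompact ℝ)
      (fun y : ℝ => ‖Complex.Gamma (σ + y * Complex.I)‖ ^ 2)
      (fun y : ℝ => 2 * Real.pi * |y| ^ (2 * σ - 1) * Real.exp (-(Real.pi * |y|))) := by
  have h := (isEquivalent_norm_Gamma_sq_atTop hσ).comp_tendsto
    (tendsto_norm_cocompact_atTop (E := ℝ))
  refine h.congr_left (Eventually.of_forall fun y => ?_)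
  simp only [Function.comp_apply, Real.norm_eq_abs]
  rcases abs_choice y with hy | hy
  · rw [hy]
  · rw [hy, ← Complex.norm_conj, ← Complex.Gamma_conj]
    simp

/-! ### Functions with vanishing moments -/

/-- Every test function is the Fourier transform of a Schwartz function, so self-adjointness of the
Fourier transform reduces the claim to testing `h` against `C_c^∞`. -/
theorem ae_eq_zero_of_fourier_eq_zero {h : ℝ → ℂ} (hh : Integrable h)
    (H : ∀ s : ℝ, ∫ x : ℝ, Complex.exp (Complex.I * s * x) * h x = 0) : h =ᵐ[volume] 0 := by
  have hF : FourierTransform.fourier h = 0 := by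
    funext s
    rw [Real.fourier_real_eq_integral_exp_smul, Pi.zero_apply, ← H (-2 * Real.pi * s)]
    refine integral_congr_ae (Eventually.of_forall fun x => ?_)
    simp only [smul_eq_mul]
    congr 2
    push_cast
    ring
  refine ae_eq_zero_of_integral_contDiff_smul_eq_zero hh.locallyIntegrable fun ψ hψ hc => ?_
  have hψc : ContDiff ℝ ((⊤ : ℕ∞) : WithTop ℕ∞) fun x => (ψ x : ℂ) :=
    Complex.ofRealCLM.contDiff.comp hψ
  have hcc : HasCompactSupport fun x => (ψ x : ℂ) := hc.comp_left (g := Complex.ofReal) (by simp)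
  let Ψ : SchwartzMap ℝ ℂ := hcc.toSchwartzMap hψc
  let η : SchwartzMap ℝ ℂ := FourierTransformInv.fourierInv Ψ
  have hη : FourierTransform.fourier (η : ℝ → ℂ) = Ψ := by
    rw [← SchwartzMap.fourier_coe]
    simp [η]
  have key := VectorFourier.integral_fourierIntegral_smul_eq_flip (L := innerₗ ℝ)
    (μ := volume) (ν := volume) (f := (η : ℝ → ℂ)) (g := h)
    Real.continuous_fourierChar continuous_inner η.integrable hh
  have hflip : (innerₗ ℝ).flip = innerₗ ℝ := by
    ext
    simp
  have e1 : VectorFourier.fourierIntegral Real.fourierChar volume (innerₗ ℝ) η = Ψ := hη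
  have e2 : VectorFourier.fourierIntegral Real.fourierChar volume (innerₗ ℝ).flip h = 0 := by
    rw [hflip]
    exact hF
  rw [e1, e2] at key
  simpa [Ψ] using key

/-- If `|h|` decays exponentially in mean and all moments of `h` vanish, then the Fourier transform
of `h` vanishes: its Taylor series at any point represents it on an interval of fixed length, so the
vanishing of all derivatives propagates from the origin to the whole line. -/
theorem integral_exp_mul_eq_zero_of_moments_eq_zero {h : ℝ → ℂ}
    (hm : AEStronglyMeasurable h) (hi : Integrable fun x => Real.exp |x| * ‖h x‖)
    (H : ∀ k : ℕ, ∫ x : ℝ, (x : ℂ) ^ k * h x = 0) (s : ℝ) :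
    ∫ x : ℝ, Complex.exp (Complex.I * s * x) * h x = 0 := by
  -- For `|t| ≤ 1/2`, half of the exponent in `exp |x|` controls the exponential series and the
  -- other half the factor `|x| ^ k`.
  have step : ∀ s t : ℝ, |t| ≤ 1 / 2 →
      (∀ k : ℕ, ∫ x : ℝ, (x : ℂ) ^ k * Complex.exp (Complex.I * s * x) * h x = 0) →
      ∀ k : ℕ, ∫ x : ℝ, (x : ℂ) ^ k * Complex.exp (Complex.I * (s + t : ℝ) * x) * h x = 0 := by
    intro s t ht hs k
    set u : ℝ → ℂ := fun x => (x : ℂ) ^ k * Complex.exp (Complex.I * s * x) * h x with hu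
    have hexp : ∀ x : ℝ, ‖Complex.exp (Complex.I * s * x)‖ = 1 := fun x => by
      rw [show Complex.I * s * x = (s * x : ℝ) * Complex.I by push_cast; ring,
        Complex.norm_exp_ofReal_mul_I]
    have hum : AEStronglyMeasurable u :=
      (by fun_prop : Continuous fun x : ℝ =>
        (x : ℂ) ^ k * Complex.exp (Complex.I * s * x)).aestronglyMeasurable.mul hm
    have hreal : ∀ x : ℝ, HasSum (fun n : ℕ => (|x| / 2) ^ n / n.factorial * (|x| ^ k * ‖h x‖))
        (Real.exp (|x| / 2) * (|x| ^ k * ‖h x‖)) := fun x => by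
      have := NormedSpace.expSeries_div_hasSum_exp (𝔸 := ℝ) (|x| / 2)
      rw [← Real.exp_eq_exp_ℝ] at this
      exact this.mul_right _
    have hsum := hasSum_integral_of_dominated_convergence (μ := volume)
      (F := fun (n : ℕ) (x : ℝ) => (Complex.I * t * x) ^ n / n.factorial * u x)
      (f := fun x : ℝ => Complex.exp (Complex.I * t * x) * u x)
      (fun n x => (|x| / 2) ^ n / n.factorial * (|x| ^ k * ‖h x‖)) ?_ ?_ ?_ ?_ ?_
    · have hz : ∀ n : ℕ, ∫ x : ℝ, (Complex.I * t * x) ^ n / n.factorial * u x = 0 := fun n => by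
        rw [← mul_zero ((Complex.I * t) ^ n / n.factorial), ← hs (k + n), ← integral_const_mul]
        refine integral_congr_ae (Eventually.of_forall fun x => ?_)
        simp only [hu]
        ring
      simp only [hz] at hsum
      rw [← hsum.unique hasSum_zero]
      refine integral_congr_ae (Eventually.of_forall fun x => ?_)
      simp only [hu]
      rw [show Complex.I * (s + t : ℝ) * x = Complex.I * t * x + Complex.I * s * x by
        push_cast; ring, Complex.exp_add]
      ring
    · exact fun n => (by fun_prop : Continuous fun x : ℝ =>
        (Complex.I * t * x) ^ n / n.factorial).aestronglyMeasurable.mul hum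
    · refine fun n => Eventually.of_forall fun x => ?_
      simp only [hu, norm_mul, norm_div, norm_pow, hexp, Complex.norm_I, Complex.norm_real,
        Complex.norm_natCast, one_mul, mul_one, Real.norm_eq_abs]
      gcongr
      rw [mul_comm, div_eq_mul_one_div]
      gcongr
    · exact Eventually.of_forall fun x => (hreal x).summable
    · simp only [fun x => (hreal x).tsum_eq]
      refine (hi.const_mul (k.factorial * 2 ^ k : ℝ)).mono' ?_ (Eventually.of_forall fun x => ?_)
      · exact (by fun_prop : Continuous fun x : ℝ => Real.exp (|x| / 2)).aestronglyMeasurable.mul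
          ((by fun_prop : Continuous fun x : ℝ => |x| ^ k).aestronglyMeasurable.mul hm.norm)
      · have h1 := Real.pow_div_factorial_le_exp (|x| / 2) (by positivity) k
        rw [div_pow, div_div, div_le_iff₀ (by positivity)] at h1
        rw [Real.norm_of_nonneg (by positivity)]
        calc Real.exp (|x| / 2) * (|x| ^ k * ‖h x‖)
            ≤ Real.exp (|x| / 2) * (Real.exp (|x| / 2) * (2 ^ k * k.factorial) * ‖h x‖) := by
              gcongr
          _ = k.factorial * 2 ^ k * (Real.exp (|x| / 2 + |x| / 2) * ‖h x‖) := by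
              rw [Real.exp_add]; ring
          _ = _ := by rw [add_halves]
    · refine Eventually.of_forall fun x => ?_
      have := NormedSpace.expSeries_div_hasSum_exp (𝔸 := ℂ) (Complex.I * t * x)
      rw [← Complex.exp_eq_exp_ℂ] at this
      exact this.mul_right _
  have iter : ∀ (t : ℝ), |t| ≤ 1 / 2 → ∀ n k : ℕ,
      ∫ x : ℝ, (x : ℂ) ^ k * Complex.exp (Complex.I * (n * t : ℝ) * x) * h x = 0 := by
    intro t ht n
    induction n with
    | zero => simpa using H
    | succ n ih =>
      have := step (n * t) t ht ih
      intro k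
      rw [← this k, Nat.cast_succ, add_one_mul]
  obtain ⟨n, hn⟩ := exists_nat_gt (2 * |s|)
  have hn0 : (0 : ℝ) < n := lt_of_le_of_lt (by positivity) hn
  have := iter (s / n) (by rw [abs_div, abs_of_pos hn0, div_le_iff₀ hn0]; linarith) n 0
  rw [mul_div_cancel₀ _ hn0.ne'] at this
  simpa using this

/-! ### The Fourier transform of the ground function and its weight -/

theorem log_one_add_tanh_sub_log_one_sub_tanh (x : ℝ) :
    Real.log (1 + Real.tanh x) - Real.log (1 - Real.tanh x) = 2 * x := by
  have h := Real.artanh_eq_half_log (x := Real.tanh x)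
    ⟨(Real.neg_one_lt_tanh x).le, (Real.tanh_lt_one x).le⟩
  rw [Real.artanh_tanh, Real.log_div (one_add_tanh_pos x).ne' (one_sub_tanh_pos x).ne'] at h
  linarith

/-- The substitution `t = tanh x` turns the Fourier kernel into powers of `1 ± t`, because
`2x = log (1 + t) - log (1 - t)`. -/
theorem one_sub_tanh_rpow_mul_exp (a b x ξ : ℝ) :
    (((1 - Real.tanh x) ^ a * (1 + Real.tanh x) ^ b : ℝ) : ℂ) *
        Complex.exp (-(Complex.I * x * ξ)) =
      (1 - Real.tanh x ^ 2) • ((1 - (Real.tanh x : ℂ)) ^ ((a + Complex.I * ξ / 2 : ℂ) - 1) *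
        (1 + (Real.tanh x : ℂ)) ^ ((b - Complex.I * ξ / 2 : ℂ) - 1)) := by
  have h1 := one_sub_tanh_pos x
  have h2 := one_add_tanh_pos x
  have hlog := log_one_add_tanh_sub_log_one_sub_tanh x
  set t := Real.tanh x
  have n1 : (1 - (t : ℂ)) ≠ 0 := by exact_mod_cast h1.ne'
  have n2 : (1 + (t : ℂ)) ≠ 0 := by exact_mod_cast h2.ne'
  have l1 : Complex.log (1 - (t : ℂ)) = Real.log (1 - t) := by
    rw [Complex.ofReal_log h1.le]; push_cast; rfl
  have l2 : Complex.log (1 + (t : ℂ)) = Real.log (1 + t) := by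
    rw [Complex.ofReal_log h2.le]; push_cast; rfl
  have hlog' : (Real.log (1 + t) : ℂ) - Real.log (1 - t) = 2 * x := by exact_mod_cast hlog
  rw [Complex.real_smul, Complex.cpow_sub _ _ n1, Complex.cpow_sub _ _ n2, Complex.cpow_one,
    Complex.cpow_one, show (((1 - t ^ 2 : ℝ)) : ℂ) = (1 - t) * (1 + t) by push_cast; ring,
    div_mul_div_comm, mul_div_cancel₀ _ (mul_ne_zero n1 n2), Complex.cpow_def_of_ne_zero n1,
    Complex.cpow_def_of_ne_zero n2, l1, l2, Real.rpow_def_of_pos h1, Real.rpow_def_of_pos h2]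
  push_cast
  rw [← Complex.exp_add, ← Complex.exp_add, ← Complex.exp_add]
  congr 1
  linear_combination (Complex.I * ξ / 2) * hlog'

theorem exists_g_eq_Gamma_mul_Gamma {α β : ℝ} (hα : -1 < α) (hβ : -1 < β) :
    ∃ C : ℝ, 0 < C ∧ ∀ ξ : ℝ, g α β ξ =
      C * Complex.Gamma ((α + 1) / 2 + Complex.I * ξ / 2) *
        Complex.Gamma ((β + 1) / 2 - Complex.I * ξ / 2) := by
  have hg := jacobiNormSq_pos hα hβ 0
  set a : ℝ := (α + 1) / 2 with ha
  set b : ℝ := (β + 1) / 2 with hb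
  have ha0 : 0 < a := by rw [ha]; linarith
  have hb0 : 0 < b := by rw [hb]; linarith
  have hG := Real.Gamma_pos_of_pos (add_pos ha0 hb0)
  have hac : ((α : ℂ) + 1) / 2 = a := by rw [ha]; push_cast; rfl
  have hbc : ((β : ℂ) + 1) / 2 = b := by rw [hb]; push_cast; rfl
  refine ⟨(√(2 * Real.pi))⁻¹ * ((√(jacobiNormSq α β 0))⁻¹ *
    (2 ^ (a + b - 1) / Real.Gamma (a + b))), by have := Real.pi_pos; positivity, fun ξ => ?_⟩
  have key : ∀ x : ℝ, (phi α β 0 x : ℂ) * Complex.exp (-(Complex.I * x * ξ)) =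
      ((√(jacobiNormSq α β 0))⁻¹ : ℝ) * ((1 - Real.tanh x ^ 2) •
        ((1 - (Real.tanh x : ℂ)) ^ ((a + Complex.I * ξ / 2 : ℂ) - 1) *
        (1 + (Real.tanh x : ℂ)) ^ ((b - Complex.I * ξ / 2 : ℂ) - 1))) := fun x => by
    rw [← one_sub_tanh_rpow_mul_exp]
    simp [phi, jacobiPoly, ← ha, ← hb]
    ring
  rw [g]
  simp only [key]
  rw [integral_const_mul, integral_comp_tanh (fun t : ℝ =>
    (1 - (t : ℂ)) ^ ((a + Complex.I * ξ / 2 : ℂ) - 1) *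
        (1 + (t : ℂ)) ^ ((b - Complex.I * ξ / 2 : ℂ) - 1)),
    integral_jacobiWeight_complex (by simpa using ha0) (by simpa using hb0),
    hac, hbc, show (a + Complex.I * ξ / 2 + (b - Complex.I * ξ / 2) : ℂ) = (a + b : ℝ) by
      push_cast; ring, Complex.Gamma_ofReal]
  simp only [Complex.ofReal_mul, Complex.ofReal_div, Complex.ofReal_cpow (zero_le_two (α := ℝ))]
  push_cast
  ring

theorem weight_eq {α β C : ℝ} (hC : ∀ ξ : ℝ, g α β ξ =
      C * Complex.Gamma ((α + 1) / 2 + Complex.I * ξ / 2) *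
        Complex.Gamma ((β + 1) / 2 - Complex.I * ξ / 2)) (ξ : ℝ) :
    weight α β ξ = C ^ 2 *
      (‖Complex.Gamma (((α + 1) / 2 : ℝ) + (ξ * 2⁻¹ : ℝ) * Complex.I)‖ ^ 2 *
      ‖Complex.Gamma (((β + 1) / 2 : ℝ) + (ξ * (-2⁻¹) : ℝ) * Complex.I)‖ ^ 2) := by
  rw [weight, hC, norm_mul, norm_mul, Complex.norm_real, mul_pow, mul_pow, Real.norm_eq_abs, sq_abs,
    mul_assoc]
  push_cast
  ring_nf

theorem weight_pos {α β : ℝ} (hα : -1 < α) (hβ : -1 < β) (ξ : ℝ) : 0 < weight α β ξ := by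
  obtain ⟨C, hC0, hC⟩ := exists_g_eq_Gamma_mul_Gamma hα hβ
  rw [weight_eq hC]
  have h1 := norm_pos_iff.2 (ofReal_add_mul_I_Gamma_ne_zero (show 0 < (α + 1) / 2 by linarith)
    (ξ * 2⁻¹))
  have h2 := norm_pos_iff.2 (ofReal_add_mul_I_Gamma_ne_zero (show 0 < (β + 1) / 2 by linarith)
    (ξ * (-2⁻¹)))
  positivity

theorem continuous_weight {α β : ℝ} (hα : -1 < α) (hβ : -1 < β) : Continuous (weight α β) := by
  obtain ⟨C, hC0, hC⟩ := exists_g_eq_Gamma_mul_Gamma hα hβ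
  have h : ∀ {σ : ℝ} (c : ℝ), 0 < σ →
      Continuous fun ξ : ℝ => Complex.Gamma (σ + (ξ * c : ℝ) * Complex.I) := fun {σ} c hσ =>
    continuous_iff_continuousAt.2 fun ξ => ContinuousAt.comp
      (f := fun ξ : ℝ => (σ + (ξ * c : ℝ) * Complex.I : ℂ)) (g := Complex.Gamma)
      (Complex.differentiableAt_Gamma _ fun m hm => by
        have := congrArg Complex.re hm
        simp at this
        have h0 := m.cast_nonneg (α := ℝ)
        linarith).continuousAt (by fun_prop)
  rw [funext (weight_eq hC)]
  exact continuous_const.mul (((h _ (by linarith)).norm.pow 2).mul ((h _ (by linarith)).norm.pow 2))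

theorem isEquivalent_weight {α β C : ℝ} (hα : -1 < α) (hβ : -1 < β) (hC : ∀ ξ : ℝ, g α β ξ =
      C * Complex.Gamma ((α + 1) / 2 + Complex.I * ξ / 2) *
        Complex.Gamma ((β + 1) / 2 - Complex.I * ξ / 2)) :
    Asymptotics.IsEquivalent (cocompact ℝ) (weight α β)
      (fun ξ : ℝ => C ^ 2 * (4 * Real.pi ^ 2 * |ξ / 2| ^ (α + β) *
        Real.exp (-(Real.pi * |ξ|)))) := by
  have hc : ∀ c : ℝ, c ≠ 0 → Tendsto (fun ξ : ℝ => ξ * c) (cocompact ℝ) (cocompact ℝ) :=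
    fun c h => (Homeomorph.mulRight₀ c h).isClosedEmbedding.tendsto_cocompact
  have h1 := (isEquivalent_norm_Gamma_sq (show 0 < (α + 1) / 2 by linarith)).comp_tendsto
    (hc 2⁻¹ (by norm_num))
  have h2 := (isEquivalent_norm_Gamma_sq (show 0 < (β + 1) / 2 by linarith)).comp_tendsto
    (hc (-2⁻¹) (by norm_num))
  have h3 := (Asymptotics.IsEquivalent.refl (u := fun _ : ℝ => C ^ 2)
    (l := cocompact ℝ)).mul (h1.mul h2)
  refine (h3.congr_left (Eventually.of_forall fun ξ => (weight_eq hC ξ).symm)).congr_right ?_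
  have hne : ∀ᶠ ξ : ℝ in cocompact ℝ, ξ ≠ 0 :=
    (isCompact_singleton (x := (0 : ℝ))).compl_mem_cocompact
  filter_upwards [hne] with ξ hξ
  have hp : 0 < |ξ / 2| := by positivity
  simp only [Pi.mul_apply, Function.comp_apply]
  rw [mul_neg, abs_neg, ← div_eq_mul_inv,
    show α + β = (2 * ((α + 1) / 2) - 1) + (2 * ((β + 1) / 2) - 1) by ring, Real.rpow_add hp,
    show -(Real.pi * |ξ|) = -(Real.pi * |ξ / 2|) + -(Real.pi * |ξ / 2|) by
      rw [abs_div, abs_two]; ring, Real.exp_add]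
  ring

/-! ### Density of the polynomials -/

theorem integrable_exp_two_mul_abs_mul_weight {α β : ℝ} (hα : -1 < α) (hβ : -1 < β) :
    Integrable fun ξ : ℝ => Real.exp (2 * |ξ|) * weight α β ξ := by
  obtain ⟨C, hC0, hC⟩ := exists_g_eq_Gamma_mul_Gamma hα hβ
  have hw := continuous_weight hα hβ
  have hpi := Real.pi_gt_three
  refine (by fun_prop : Continuous fun ξ : ℝ =>
    Real.exp (2 * |ξ|) * weight α β ξ).locallyIntegrable.integrable_of_isBigO_cocompact
      (g := fun ξ : ℝ => (1 + ξ ^ 2)⁻¹) ?_ (integrable_inv_one_add_sq.integrableAtFilter _)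
  refine ((Asymptotics.isBigO_refl (fun ξ : ℝ => Real.exp (2 * |ξ|)) _).mul
    (isEquivalent_weight hα hβ hC).isBigO).trans ?_
  -- In terms of `t = |ξ / 2|`, the quotient to be bounded is asymptotically
  -- `4π²C² t^(α+β) exp (-(2π - 4) t) (1 + 4t²)`.
  have hlim : Tendsto (fun t : ℝ => 4 * C ^ 2 * Real.pi ^ 2 *
      (t ^ (α + β) * Real.exp (-(2 * Real.pi - 4) * t) +
        4 * (t ^ (α + β + 2) * Real.exp (-(2 * Real.pi - 4) * t)))) atTop (𝓝 0) := by
    have h := fun s => tendsto_rpow_mul_exp_neg_mul_atTop_nhds_zero s (2 * Real.pi - 4)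
      (by linarith)
    simpa using ((h (α + β)).add ((h (α + β + 2)).const_mul 4)).const_mul (4 * C ^ 2 * Real.pi ^ 2)
  have hhalf : Tendsto (fun ξ : ℝ => |ξ / 2|) (cocompact ℝ) atTop := by
    simp only [abs_div, abs_two]
    exact (tendsto_norm_cocompact_atTop (E := ℝ)).atTop_div_const two_pos
  refine (Asymptotics.isBigO_iff_div_isBoundedUnder ?_).2 ?_
  · exact Eventually.of_forall fun ξ h => absurd h (by positivity)
  · refine Tendsto.isBoundedUnder_le (a := 0) ?_
    have := (hlim.comp hhalf).norm
    rw [norm_zero] at this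
    refine this.congr' ?_
    filter_upwards [hhalf.eventually_gt_atTop 0] with ξ hξ
    simp only [Function.comp_apply]
    congr 1
    have e1 : |ξ| = 2 * |ξ / 2| := by rw [abs_div, abs_two]; ring
    have e2 : ξ ^ 2 = 4 * |ξ / 2| ^ 2 := by rw [sq_abs]; ring
    rw [div_inv_eq_mul, e1, e2, Real.rpow_add hξ _ 2, Real.rpow_two,
      show -(2 * Real.pi - 4) * |ξ / 2| = 2 * (2 * |ξ / 2|) + -(Real.pi * (2 * |ξ / 2|)) by ring,
      Real.exp_add]
    ring

theorem integrable_mu_iff {α β : ℝ} (hα : -1 < α) (hβ : -1 < β) (f : ℝ → ℝ) :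
    Integrable f (mu α β) ↔ Integrable fun ξ => f ξ * weight α β ξ := by
  rw [mu, integrable_withDensity_iff (continuous_weight hα hβ).measurable.ennreal_ofReal
    (Eventually.of_forall fun _ => ENNReal.ofReal_lt_top)]
  simp only [ENNReal.toReal_ofReal (weight_pos hα hβ _).le]

theorem integral_mu {α β : ℝ} (hα : -1 < α) (hβ : -1 < β) (f : ℝ → ℝ) :
    ∫ ξ, f ξ ∂mu α β = ∫ ξ, f ξ * weight α β ξ := by
  rw [mu, integral_withDensity_eq_integral_toReal_smul
    (continuous_weight hα hβ).measurable.ennreal_ofReal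
    (Eventually.of_forall fun _ => ENNReal.ofReal_lt_top)]
  simp only [ENNReal.toReal_ofReal (weight_pos hα hβ _).le, smul_eq_mul, mul_comm]

theorem memLp_exp_abs_mu {α β : ℝ} (hα : -1 < α) (hβ : -1 < β) :
    MemLp (fun ξ : ℝ => Real.exp |ξ|) 2 (mu α β) := by
  rw [memLp_two_iff_integrable_sq (by fun_prop : Continuous fun ξ : ℝ =>
    Real.exp |ξ|).aestronglyMeasurable, integrable_mu_iff hα hβ]
  convert integrable_exp_two_mul_abs_mul_weight hα hβ using 3 with ξ
  rw [← Real.exp_nat_mul]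
  norm_num

theorem memLp_pow_mu {α β : ℝ} (hα : -1 < α) (hβ : -1 < β) (k : ℕ) :
    MemLp (fun ξ : ℝ => ξ ^ k) 2 (mu α β) := by
  refine ((memLp_exp_abs_mu hα hβ).const_mul (k.factorial : ℝ)).mono
    (by fun_prop : Continuous fun ξ : ℝ => ξ ^ k).aestronglyMeasurable
    (Eventually.of_forall fun ξ => ?_)
  have h := Real.pow_div_factorial_le_exp |ξ| (abs_nonneg _) k
  rw [div_le_iff₀ (by positivity)] at h
  rw [norm_pow, Real.norm_eq_abs, Real.norm_of_nonneg (by positivity)]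
  linarith

theorem memLp_polynomial_mu {𝕜 : Type*} [RCLike 𝕜] {α β : ℝ} (hα : -1 < α) (hβ : -1 < β)
    (p : 𝕜[X]) : MemLp (fun ξ : ℝ => p.eval (ξ : 𝕜)) 2 (mu α β) := by
  simp only [Polynomial.eval_eq_sum_range]
  refine memLp_finsetSum _ fun k _ => MemLp.const_mul ?_ _
  simpa using (memLp_pow_mu hα hβ k).ofReal (K := 𝕜)

theorem ae_eq_zero_of_moments_mu_eq_zero {α β : ℝ} (hα : -1 < α) (hβ : -1 < β) {f : ℝ → ℝ}
    (hf : MemLp f 2 (mu α β)) (H : ∀ k : ℕ, ∫ ξ, ξ ^ k * f ξ ∂mu α β = 0) :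
    f =ᵐ[mu α β] 0 := by
  have hexp : Integrable fun ξ => Real.exp |ξ| * f ξ * weight α β ξ :=
    (integrable_mu_iff hα hβ _).1 ((memLp_exp_abs_mu hα hβ).integrable_mul hf)
  have h0 : Integrable fun ξ => f ξ * weight α β ξ := by
    have := (integrable_mu_iff hα hβ _).1 ((memLp_pow_mu hα hβ 0).integrable_mul hf)
    simpa using this
  have hmom : ∀ k : ℕ, ∫ ξ : ℝ, (ξ : ℂ) ^ k * ((f ξ * weight α β ξ : ℝ) : ℂ) = 0 := fun k => by
    have := H k
    rw [integral_mu hα hβ] at this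
    rw [← Complex.ofReal_zero, ← this, ← integral_complex_ofReal]
    refine integral_congr_ae (Eventually.of_forall fun ξ => ?_)
    push_cast
    ring
  have hz := ae_eq_zero_of_fourier_eq_zero h0.ofReal
    (integral_exp_mul_eq_zero_of_moments_eq_zero h0.ofReal.aestronglyMeasurable
      (hexp.norm.congr (Eventually.of_forall fun ξ => by simp [mul_assoc])) hmom)
  refine (withDensity_absolutelyContinuous _ _).ae_le ?_
  filter_upwards [hz] with ξ hξ
  have := Complex.ofReal_eq_zero.1 hξ
  exact (mul_eq_zero.1 this).resolve_right (weight_pos hα hβ ξ).ne'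

theorem dense_range_polynomial_toLp {𝕜 : Type*} [RCLike 𝕜] {α β : ℝ} (hα : -1 < α) (hβ : -1 < β)
    (hp : ∀ p : 𝕜[X], MemLp (fun ξ : ℝ => p.eval (ξ : 𝕜)) 2 (mu α β)) :
    Dense (range fun p : 𝕜[X] => (hp p).toLp) := by
  have he : ∀ k : ℕ, MemLp (fun ξ : ℝ => ((ξ ^ k : ℝ) : 𝕜)) 2 (mu α β) := fun k =>
    (memLp_pow_mu hα hβ k).ofReal
  have hd := Submodule.dense_iff_topologicalClosure_eq_top.2
    (topologicalClosure_span_eq_top_of_forall_real he fun f hf H =>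
      ae_eq_zero_of_moments_mu_eq_zero hα hβ hf H)
  let T : 𝕜[X] →ₗ[𝕜] Lp 𝕜 2 (mu α β) :=
    { toFun := fun p => (hp p).toLp
      map_add' := fun p q => by
        rw [← MemLp.toLp_add]
        exact MemLp.toLp_congr _ _ (Eventually.of_forall fun ξ => by simp)
      map_smul' := fun c p => by
        rw [RingHom.id_apply, ← MemLp.toLp_const_smul]
        exact MemLp.toLp_congr _ _ (Eventually.of_forall fun ξ => by simp) }
  have hle : Submodule.span 𝕜 (range fun k => (he k).toLp) ≤ LinearMap.range T := by
    rw [Submodule.span_le]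
    rintro _ ⟨k, rfl⟩
    exact ⟨Polynomial.X ^ k, MemLp.toLp_congr (hp _) (he k) (Eventually.of_forall fun ξ => by simp)⟩
  exact hd.mono fun x hx => hle hx

end TanhJacobi

theorem mainTheorem5 {𝕜 : Type*} [RCLike 𝕜] (α β : ℝ) (hα : -1 < α) (hβ : -1 < β) :
    -- the system is orthonormal and complete in L²(ℝ)
    (∃ hφ : ∀ m : ℕ, MeasureTheory.MemLp (fun x : ℝ => (TanhJacobi.phi α β m x : 𝕜)) 2
          MeasureTheory.volume,
        Orthonormal 𝕜 (fun m : ℕ => (hφ m).toLp) ∧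
        (Submodule.span 𝕜 (Set.range fun m : ℕ => (hφ m).toLp)).topologicalClosure = ⊤) ∧
    -- the weight never vanishes
    (∀ ξ : ℝ, 0 < TanhJacobi.weight α β ξ) ∧
    -- the Gamma function formula for `g`, and the exponential decay of the weight
    (∃ C : ℝ, 0 < C ∧
        (∀ ξ : ℝ, TanhJacobi.g α β ξ =
          C * Complex.Gamma ((α + 1) / 2 + Complex.I * ξ / 2) *
            Complex.Gamma ((β + 1) / 2 - Complex.I * ξ / 2)) ∧
        Asymptotics.IsEquivalent (Filter.cocompact ℝ) (TanhJacobi.weight α β)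
          (fun ξ : ℝ => C ^ 2 * (4 * Real.pi ^ 2 * |ξ / 2| ^ (α + β) *
            Real.exp (-(Real.pi * |ξ|))))) ∧
    -- polynomials belong to L²(μ) and are dense there
    (∃ hp : ∀ p : Polynomial 𝕜, MeasureTheory.MemLp (fun ξ : ℝ => p.eval (ξ : 𝕜)) 2
          (TanhJacobi.mu α β),
        Dense (Set.range fun p : Polynomial 𝕜 => (hp p).toLp)) := by
  obtain ⟨C, hC0, hC⟩ := TanhJacobi.exists_g_eq_Gamma_mul_Gamma hα hβ
  refine ⟨⟨fun m => (TanhJacobi.memLp_phi hα hβ m).ofReal, TanhJacobi.orthonormal_phi hα hβ _,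
    TanhJacobi.topologicalClosure_span_eq_top_of_forall_real _ fun f hf H =>
      TanhJacobi.ae_eq_zero_of_integral_phi_mul_eq_zero hα hβ hf H⟩,
    TanhJacobi.weight_pos hα hβ, ⟨C, hC0, hC, TanhJacobi.isEquivalent_weight hα hβ hC⟩,
    ⟨TanhJacobi.memLp_polynomial_mu hα hβ, TanhJacobi.dense_range_polynomial_toLp hα hβ _⟩⟩
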